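/- For $x>0$ let $\mathrm{Ci}(x)=-\int_x^\infty \frac{\cos t}{t}\,dt$ (a convergent improper integral) be the cosine integral, let $J_m(x)=\sum_{k=0}^\infty \frac{(-1)^k}{k!\,(m+k)!}\left(\frac{x}{2}\right)^{2k+m}$ be the Bessel function of the first kind of order $m\in\{0,1,2,\dots\}$, and let $\gamma$ be Euler's constant. For $n\ge 1$ put $$H_n=\sum_{k=1}^n\frac1k,\qquad A_n=\sum_{k=1}^n\frac{(-1)^{k-1}}{k},\qquad \beta_n=H_n+A_n-\frac{1}{2n}-\frac{(-1)^{n-1}}{2n}.$$ Then for every integer $n\ge 1$ both integrals below converge absolutely, and $$\int_0^\infty\bigl[\gamma+\log t-\mathrm{Ci}(t)\bigr]J_{2n}(t)\,\frac{dt}{t}=\frac{1}{2n}\int_0^{\pi/2}\bigl[1-\cos(2nt)\bigr]\cot t\,dt=\frac{\beta_n}{2n}=\sum_{j=0}^{n-1}\frac{(-1)^j2^{2j}}{(j+1)\,(2j+2)!}\,\frac{(n+j)!}{(n-j-1)!}.$$ -/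

import Mathlib

open MeasureTheory Filter Topology Set
open scoped Nat

noncomputable section

/-- The cosine integral `Ci x = -∫_x^∞ cos t / t dt` for `x > 0`. The integral converges only
conditionally, so it is the limit of `∫_x^R cos t / t dt` as `R → ∞`. -/
def cosineIntegral (x : ℝ) : ℝ :=
  -limUnder atTop (fun R : ℝ => ∫ t in x..R, Real.cos t / t)

/-- The Bessel function of the first kind `J_m` of order `m = 0, 1, 2, …`, by its
(everywhere absolutely convergent) power series. -/
def besselJ (m : ℕ) (x : ℝ) : ℝ :=
  ∑' k : ℕ, (-1 : ℝ) ^ k / ((k ! : ℝ) * ((m + k)! : ℝ)) * (x / 2) ^ (2 * k + m)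

/-- The alternating harmonic number `A_n = ∑_{k=1}^n (-1)^(k-1) / k`. -/
def altHarmonic (n : ℕ) : ℝ :=
  ∑ k ∈ Finset.Icc 1 n, (-1 : ℝ) ^ (k - 1) / (k : ℝ)

/-- The coefficient `β_n = H_n + A_n - 1/(2n) - (-1)^(n-1)/(2n)` (for `n ≥ 1`), where
`H_n = ∑_{k=1}^n 1/k` is the harmonic number. -/
def neumannBeta (n : ℕ) : ℝ :=
  (harmonic n : ℝ) + altHarmonic n - 1 / (2 * (n : ℝ)) - (-1 : ℝ) ^ (n - 1) / (2 * (n : ℝ))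

end

/-! The bracket `γ + log t - Ci t` is the entire function `cin t = ∫₀ᵗ (1 - cos u)/u du`
(`cosineIntegral_eq`), so all singular terms disappear from the Bessel integral. Both integrals then
obey the same recursion in `n`. Differentiating `cin * (J_m + J_{m+2})` gives `(m+2) I_{m+2} - m I_m
= ∫ (1 - cos t)/t * (J_m + J_{m+2})`, where `I_m = ∫ cin * J_m / t`. On the trigonometric side, `(1
- cos 2nt) cot t` telescopes into sines. In both cases the increment is `oddReciprocal (n+1) +
oddReciprocal n`, which is also that of `neumannBeta`. The delicate increment is `∫ (1 - cos t)/t *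
J₀ = 0` (`integral_cinKernel_mul_besselJ_zero`). It follows from the integral representation of `J₀`
and a Frullani-type limit, which leaves `∫ log |cos| = ∫ log sin` over `[0, π]`. For `J_{2n}` with
`n ≥ 1`, the integrals of `J_{2n}/t` and `cos t * J_{2n}/t` come from explicit primitives. Absolute
convergence rests on `J_m(t) = O(t^(-1/2))` (`besselJ_isBigO`). The finite sum results from
expanding `cos 2nt` in powers of `sin t` and integrating against `cot t` (`neumannBeta_div_eq_sum`).
-/

/-! ### Bessel power series: recurrence and derivatives. -/

/-- The `k`-th term of the power series of `besselJ m`. -/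
noncomputable def besselTerm (m k : ℕ) (x : ℝ) : ℝ :=
  (-1 : ℝ) ^ k / ((k ! : ℝ) * ((m + k)! : ℝ)) * (x / 2) ^ (2 * k + m)

lemma summable_besselTerm (m : ℕ) (x : ℝ) : Summable fun k => besselTerm m k x := by
  refine Summable.of_norm_bounded
    (g := fun k => ((x / 2) ^ 2) ^ k / (k ! : ℝ) * |x / 2| ^ m)
    ((Real.summable_pow_div_factorial _).mul_right _) fun k => ?_
  have h1 : (1 : ℝ) ≤ ((m + k)! : ℝ) := by exact_mod_cast Nat.one_le_iff_ne_zero.2 (Nat.factorial_ne_zero _)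
  have h2 : (0 : ℝ) < (k ! : ℝ) := by positivity
  rw [besselTerm, norm_mul, norm_div, norm_pow, norm_neg, norm_one, one_pow, norm_pow,
    Real.norm_eq_abs, Real.norm_eq_abs, abs_of_pos (by positivity), pow_add, pow_mul, sq_abs,
    ← mul_assoc]
  gcongr
  rw [div_mul_eq_mul_div, one_mul]
  gcongr
  nlinarith

lemma hasSum_besselJ (m : ℕ) (x : ℝ) : HasSum (fun k => besselTerm m k x) (besselJ m x) :=
  (summable_besselTerm m x).hasSum

/-- Together with `hasSum_besselTerm_upper`, this puts `J_m` and `-J_{m+2}` over the common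
denominator `k! (m+1+k)!` with numerators `m+1+k` and `k`. Their difference `m+1` yields the
three-term recurrence, their sum `2k+m+1` the derivative of `J_{m+1}`. -/
lemma hasSum_besselTerm_lower (m : ℕ) (x : ℝ) :
    HasSum (fun k : ℕ => (-1 : ℝ) ^ k * ((m : ℝ) + 1 + k) / ((k ! : ℝ) * ((m + 1 + k)! : ℝ)) *
      (x / 2) ^ (2 * k + m)) (besselJ m x) := by
  convert hasSum_besselJ m x using 2 with k
  rw [besselTerm, show m + 1 + k = m + k + 1 by ring, Nat.factorial_succ]
  push_cast
  have : (m : ℝ) + k + 1 ≠ 0 := by positivity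
  field_simp
  ring

lemma hasSum_besselTerm_upper (m : ℕ) (x : ℝ) :
    HasSum (fun k : ℕ => (-1 : ℝ) ^ k * (k : ℝ) / ((k ! : ℝ) * ((m + 1 + k)! : ℝ)) *
      (x / 2) ^ (2 * k + m)) (-besselJ (m + 2) x) := by
  -- The term `k = 0` vanishes, so shifting the index by one gives the series of `J_{m+2}` with
  -- opposite sign.
  refine (hasSum_nat_add_iff' 1).1 ?_
  convert (hasSum_besselJ (m + 2) x).neg using 2 with k
  · rw [besselTerm, show m + 1 + (k + 1) = m + 2 + k by ring, Nat.factorial_succ,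
      show 2 * (k + 1) + m = 2 * k + (m + 2) by ring]
    push_cast
    field_simp
    ring
  · simp

lemma besselJ_recurrence (m : ℕ) (x : ℝ) :
    2 * ((m : ℝ) + 1) * besselJ (m + 1) x = x * (besselJ m x + besselJ (m + 2) x) := by
  have h := ((hasSum_besselTerm_lower m x).sub (hasSum_besselTerm_upper m x)).mul_left x
  have h' := (hasSum_besselJ (m + 1) x).mul_left (2 * ((m : ℝ) + 1))
  rw [sub_neg_eq_add] at h
  refine h'.unique ?_
  convert h using 2 with k
  rw [besselTerm, show 2 * k + (m + 1) = 2 * k + m + 1 by ring, pow_succ]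
  ring

lemma besselJ_zero (m : ℕ) : besselJ m 0 = if m = 0 then 1 else 0 := by
  rw [besselJ, tsum_eq_single 0]
  · cases m <;> simp
  · intro k hk
    simp [hk]

/-- The termwise derivative of the power series of `besselJ m`. -/
lemma hasDerivAt_besselJ_tsum (m : ℕ) (x : ℝ) :
    HasDerivAt (besselJ m) (∑' k : ℕ, (-1 : ℝ) ^ k / ((k ! : ℝ) * ((m + k)! : ℝ)) *
      (((2 * k + m : ℕ) : ℝ) * (x / 2) ^ (2 * k + m - 1) * (1 / 2))) x := by
  set R : ℝ := |x| + 1 with hR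
  have hR1 : 1 ≤ R := by have := abs_nonneg x; linarith
  change HasDerivAt (fun z => ∑' k : ℕ, besselTerm m k z) _ x
  refine hasDerivAt_tsum_of_isPreconnected (t := Metric.ball (0 : ℝ) R) (y₀ := 0)
    (u := fun k => (R ^ 2) ^ k / (k ! : ℝ) * R ^ m)
    ((Real.summable_pow_div_factorial _).mul_right _) Metric.isOpen_ball
    (convex_ball _ _).isPreconnected (g := fun k y => besselTerm m k y)
    (g' := fun k y => (-1 : ℝ) ^ k / ((k ! : ℝ) * ((m + k)! : ℝ)) *
      (((2 * k + m : ℕ) : ℝ) * (y / 2) ^ (2 * k + m - 1) * (1 / 2))) ?_ ?_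
    (by simp only [Metric.mem_ball, dist_self]; linarith) (summable_besselTerm m 0)
    (by rw [mem_ball_zero_iff, Real.norm_eq_abs]; linarith)
  · intro k y _
    exact (((hasDerivAt_id y).div_const 2).pow _).const_mul _
  · intro k y hy
    have hy' : |y / 2| ≤ R := by
      rw [mem_ball_zero_iff, Real.norm_eq_abs] at hy
      rw [abs_div, abs_two]
      have := abs_nonneg y
      linarith
    have h1 : ((2 * k + m : ℕ) : ℝ) ≤ 2 * ((m + k)! : ℝ) := by
      have := Nat.self_le_factorial (m + k)
      exact_mod_cast (by omega : 2 * k + m ≤ 2 * (m + k)!)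
    have h2 : |y / 2| ^ (2 * k + m - 1) ≤ R ^ (2 * k + m) :=
      (pow_le_pow_left₀ (abs_nonneg _) hy' _).trans (pow_le_pow_right₀ hR1 (by omega))
    have h3 : ‖(-1 : ℝ) ^ k / ((k ! : ℝ) * ((m + k)! : ℝ))‖ = 1 / ((k ! : ℝ) * ((m + k)! : ℝ)) := by
      simp
    rw [norm_mul, h3, norm_mul, norm_mul, norm_pow, Real.norm_natCast, Real.norm_eq_abs,
      Real.norm_of_nonneg (by norm_num : (0 : ℝ) ≤ 1 / 2)]
    calc 1 / ((k ! : ℝ) * ((m + k)! : ℝ)) * (((2 * k + m : ℕ) : ℝ) * |y / 2| ^ (2 * k + m - 1) * (1 / 2))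
        ≤ 1 / ((k ! : ℝ) * ((m + k)! : ℝ)) * (2 * ((m + k)! : ℝ) * R ^ (2 * k + m) * (1 / 2)) := by
          gcongr
      _ = (R ^ 2) ^ k / (k ! : ℝ) * R ^ m := by
          rw [pow_add, pow_mul]; field_simp

lemma hasDerivAt_besselJ_succ (m : ℕ) (x : ℝ) :
    HasDerivAt (besselJ (m + 1)) ((besselJ m x - besselJ (m + 2) x) / 2) x := by
  convert hasDerivAt_besselJ_tsum (m + 1) x using 1
  have h := ((hasSum_besselTerm_lower m x).add (hasSum_besselTerm_upper m x)).div_const 2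
  rw [← sub_eq_add_neg] at h
  rw [← h.tsum_eq]
  refine tsum_congr fun k => ?_
  rw [show 2 * k + (m + 1) - 1 = 2 * k + m by omega]
  push_cast
  ring

lemma hasDerivAt_besselJ_zero (x : ℝ) : HasDerivAt (besselJ 0) (-besselJ 1 x) x := by
  convert hasDerivAt_besselJ_tsum 0 x using 1
  refine (HasSum.tsum_eq ?_).symm
  refine (hasSum_nat_add_iff' 1).1 ?_
  convert (hasSum_besselJ 1 x).neg using 2 with k
  · rw [besselTerm, show 0 + (k + 1) = 1 + k by ring, Nat.factorial_succ k,
      show 2 * (k + 1) + 0 - 1 = 2 * k + 1 by omega]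
    push_cast
    field_simp
    ring
  · simp

lemma continuous_besselJ (m : ℕ) : Continuous (besselJ m) :=
  continuous_iff_continuousAt.2 fun x => (hasDerivAt_besselJ_tsum m x).continuousAt

/-! ### Decay of the Bessel functions at infinity. -/

/-- The energy controlling the decay of `J₀` and `J₁`: times `exp (1/t)` it is nonincreasing. -/
lemma hasDerivAt_besselEnergy {x : ℝ} (hx : 0 < x) :
    HasDerivAt (fun t => t * (besselJ 0 t ^ 2 + besselJ 1 t ^ 2) - besselJ 0 t * besselJ 1 t)
      (besselJ 0 x * besselJ 1 x / x) x := by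
  have h0 := hasDerivAt_besselJ_zero x
  have h1 := hasDerivAt_besselJ_succ 0 x
  have hr := besselJ_recurrence 0 x
  simp only [zero_add, Nat.cast_zero, mul_one] at h1 hr
  have h2 : besselJ 2 x = 2 * besselJ 1 x / x - besselJ 0 x := by field_simp; linarith
  rw [h2] at h1
  refine (((hasDerivAt_id x).mul ((h0.pow 2).add (h1.pow 2))).sub (h0.mul h1)).congr_deriv ?_
  simp only [id, Pi.add_apply, Pi.pow_apply]
  field_simp
  push_cast
  ring

lemma besselJ_zero_one_decay :
    ∃ C : ℝ, ∀ x : ℝ, 1 ≤ x → x * (besselJ 0 x ^ 2 + besselJ 1 x ^ 2) ≤ C := by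
  set Q : ℝ → ℝ := fun t => t * (besselJ 0 t ^ 2 + besselJ 1 t ^ 2) - besselJ 0 t * besselJ 1 t
  -- For `x ≥ 1` the cross term `J₀ J₁ ≤ (J₀² + J₁²)/2` takes away at most half of the main term.
  have hS : ∀ x, 1 ≤ x → x * (besselJ 0 x ^ 2 + besselJ 1 x ^ 2) ≤ 2 * Q x := fun x hx => by
    simp only [Q]
    nlinarith [sq_nonneg (besselJ 0 x - besselJ 1 x),
      mul_nonneg (sub_nonneg.2 hx) (add_nonneg (sq_nonneg (besselJ 0 x)) (sq_nonneg (besselJ 1 x)))]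
  have hd : ∀ x, 0 < x → HasDerivAt (fun t => Q t * Real.exp (t⁻¹))
      (besselJ 0 x * besselJ 1 x / x * Real.exp (x⁻¹) +
        Q x * (Real.exp (x⁻¹) * (-(x ^ 2)⁻¹))) x := fun x hx =>
    (hasDerivAt_besselEnergy hx).mul (hasDerivAt_inv hx.ne').exp
  have hanti : AntitoneOn (fun t => Q t * Real.exp (t⁻¹)) (Ici 1) := by
    refine antitoneOn_of_deriv_nonpos (convex_Ici 1) ?_ ?_ ?_
    · exact fun x hx => (hd x (by linarith [mem_Ici.1 hx])).continuousAt.continuousWithinAt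
    · rw [interior_Ici]
      exact fun x hx => (hd x (by linarith [mem_Ioi.1 hx])).differentiableAt.differentiableWithinAt
    · rw [interior_Ici]
      intro x hx
      have hx1 : 1 < x := hx
      have hx0 : 0 < x := by linarith
      rw [(hd x hx0).deriv]
      -- This is `Q' ≤ Q / x²`, a Gronwall inequality with integrable rate; hence the integrating
      -- factor `exp (1/x)`.
      have h1 : besselJ 0 x * besselJ 1 x / x ≤ Q x * (x ^ 2)⁻¹ := by
        rw [← div_eq_mul_inv, div_le_div_iff₀ hx0 (by positivity)]
        have := hS x hx1.le
        nlinarith [sq_nonneg (besselJ 0 x - besselJ 1 x), mul_pos hx0 hx0]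
      have := Real.exp_pos (x⁻¹)
      nlinarith
  refine ⟨2 * (Q 1 * Real.exp 1), fun x hx => (hS x hx).trans ?_⟩
  have h := hanti (mem_Ici.2 le_rfl) (mem_Ici.2 hx) hx
  simp only [inv_one] at h
  have h0 : 0 ≤ Q x := by
    have := hS x hx
    have : 0 ≤ x * (besselJ 0 x ^ 2 + besselJ 1 x ^ 2) := by positivity
    linarith
  have h1 : 1 ≤ Real.exp x⁻¹ := Real.one_le_exp (by positivity)
  nlinarith

lemma besselJ_isBigO (m : ℕ) : besselJ m =O[atTop] fun t : ℝ => t ^ (-(1 / 2) : ℝ) := by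
  obtain ⟨C, hC⟩ := besselJ_zero_one_decay
  have key : ∀ f : ℝ → ℝ, (∀ x, 1 ≤ x → x * f x ^ 2 ≤ C) →
      f =O[atTop] fun t : ℝ => t ^ (-(1 / 2) : ℝ) := fun f hf => by
    refine Asymptotics.IsBigO.of_bound (√C) ?_
    filter_upwards [eventually_ge_atTop 1] with x hx
    have hx0 : 0 < x := by linarith
    rw [Real.norm_of_nonneg (by positivity : (0 : ℝ) ≤ x ^ (-(1 / 2) : ℝ)), Real.rpow_neg hx0.le,
      ← Real.sqrt_eq_rpow, ← div_eq_mul_inv, le_div_iff₀ (Real.sqrt_pos.2 hx0), Real.norm_eq_abs]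
    refine Real.le_sqrt_of_sq_le ?_
    rw [mul_pow, sq_abs, Real.sq_sqrt hx0.le, mul_comm]
    exact hf x hx
  have h01 : besselJ 0 =O[atTop] (fun t : ℝ => t ^ (-(1 / 2) : ℝ)) ∧
      besselJ 1 =O[atTop] (fun t : ℝ => t ^ (-(1 / 2) : ℝ)) :=
    ⟨key _ fun x hx => by nlinarith [hC x hx, sq_nonneg (besselJ 1 x)],
      key _ fun x hx => by nlinarith [hC x hx, sq_nonneg (besselJ 0 x)]⟩
  -- Consecutive orders are carried together, since `J_{m+2} = 2(m+1)/t * J_{m+1} - J_m` and the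
  -- coefficient `2(m+1)/t` is bounded at infinity.
  suffices H : ∀ m, besselJ m =O[atTop] (fun t : ℝ => t ^ (-(1 / 2) : ℝ)) ∧
      besselJ (m + 1) =O[atTop] (fun t : ℝ => t ^ (-(1 / 2) : ℝ)) from (H m).1
  intro m
  induction m with
  | zero => exact h01
  | succ m ih =>
    refine ⟨ih.2, ?_⟩
    have hb : (fun t : ℝ => 2 * ((m : ℝ) + 1) * t⁻¹) =O[atTop] fun _ => (1 : ℝ) :=
      (tendsto_inv_atTop_zero.const_mul _).isBigO_one ℝ
    have h := hb.mul ih.2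
    simp only [one_mul] at h
    refine (h.sub ih.1).congr' ?_ EventuallyEq.rfl
    filter_upwards [eventually_gt_atTop 0] with x hx
    have := besselJ_recurrence m x
    field_simp
    linarith

lemma tendsto_besselJ_atTop (m : ℕ) : Tendsto (besselJ m) atTop (𝓝 0) :=
  (besselJ_isBigO m).trans_tendsto (tendsto_rpow_neg_atTop (by norm_num))

/-! ### Integral representation of order zero. -/

/-- The integral representation of `J₀`. -/
lemma besselJ_zero_eq_integral (t : ℝ) :
    besselJ 0 t = 1 / Real.pi * ∫ θ in (0 : ℝ)..Real.pi, Real.cos (t * Real.sin θ) := by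
  have hs : HasSum (fun k : ℕ => ∫ θ in (0 : ℝ)..Real.pi,
      (-1 : ℝ) ^ k * (t * Real.sin θ) ^ (2 * k) / ((2 * k)! : ℝ))
      (∫ θ in (0 : ℝ)..Real.pi, Real.cos (t * Real.sin θ)) := by
    refine intervalIntegral.hasSum_integral_of_dominated_convergence
      (fun k _ => |t| ^ (2 * k) / ((2 * k)! : ℝ)) (fun k => ?_) (fun k => ?_) ?_ ?_ ?_
    · exact (by fun_prop : Continuous fun θ : ℝ =>
        (-1 : ℝ) ^ k * (t * Real.sin θ) ^ (2 * k) / ((2 * k)! : ℝ)).aestronglyMeasurable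
    · refine Eventually.of_forall fun θ _ => ?_
      rw [norm_div, norm_mul, norm_pow, norm_neg, norm_one, one_pow, one_mul, norm_pow, norm_mul,
        Real.norm_natCast, Real.norm_eq_abs, Real.norm_eq_abs]
      gcongr
      exact mul_le_of_le_one_right (abs_nonneg _) (Real.abs_sin_le_one θ)
    · exact Eventually.of_forall fun θ _ => (Real.summable_pow_div_factorial |t|).comp_injective
        (i := fun k : ℕ => 2 * k) (fun a b h => by simpa using h)
    · exact intervalIntegrable_const
    · exact Eventually.of_forall fun θ _ => Real.hasSum_cos _
  refine (hasSum_besselJ 0 t).unique ((hs.mul_left (1 / Real.pi)).congr_fun fun k => ?_)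
  have hpi := Real.pi_ne_zero
  have hfac : ∀ θ : ℝ, (-1 : ℝ) ^ k * (t * Real.sin θ) ^ (2 * k) / ((2 * k)! : ℝ) =
      (-1 : ℝ) ^ k * t ^ (2 * k) / ((2 * k)! : ℝ) * Real.sin θ ^ (2 * k) := fun θ => by
    rw [mul_pow]; ring
  simp_rw [hfac, intervalIntegral.integral_const_mul, integral_sin_pow_even]
  -- The Wallis product for the integral of `sin ^ (2k)` cancels the `(2k)!` of the cosine series
  -- and leaves `4^k (k!)²`.
  have hprod : (∏ i ∈ Finset.range k, (2 * (i : ℝ) + 1) / (2 * i + 2)) =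
      ((2 * k)! : ℝ) / (4 ^ k * (k ! : ℝ) ^ 2) := by
    clear hfac
    induction k with
    | zero => simp
    | succ k ih =>
      rw [Finset.prod_range_succ, ih, show 2 * (k + 1) = 2 * k + 1 + 1 by ring,
        Nat.factorial_succ (2 * k + 1), Nat.factorial_succ (2 * k), Nat.factorial_succ k]
      push_cast
      field_simp
      ring
  rw [hprod, besselTerm, zero_add, add_zero, div_pow, pow_mul 2, show (2 : ℝ) ^ 2 = 4 by norm_num]
  field_simp

/-! ### The coefficients `β_n` and the cotangent integral. -/

/-- The common increment `(1 - (-1)^k) / (2k)` of the recursions below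
(it vanishes for `k = 0`). -/
noncomputable def oddReciprocal (k : ℕ) : ℝ := (1 - (-1 : ℝ) ^ k) / (2 * (k : ℝ))

lemma neumannBeta_succ (n : ℕ) :
    neumannBeta (n + 1) = neumannBeta n + (oddReciprocal (n + 1) + oddReciprocal n) := by
  rw [neumannBeta, neumannBeta, harmonic_succ, altHarmonic, Finset.sum_Icc_succ_top (by omega),
    ← altHarmonic, oddReciprocal, oddReciprocal]
  rcases n with _ | n
  · norm_num [altHarmonic]
  · simp only [Nat.add_sub_cancel]
    push_cast
    field_simp
    ring

lemma neumannBeta_zero : neumannBeta 0 = 0 := by simp [neumannBeta, altHarmonic]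

lemma neumannBeta_eq_sum (n : ℕ) :
    neumannBeta n = ∑ k ∈ Finset.range n, (oddReciprocal (k + 1) + oddReciprocal k) := by
  induction n with
  | zero => simp [neumannBeta_zero]
  | succ n ih => rw [neumannBeta_succ, Finset.sum_range_succ, ih]

/-- Telescoping: `(cos 2kt - cos 2(k+1)t) cot t = 2 sin((2k+1)t) cos t = sin 2(k+1)t + sin 2kt`. At
zeros of `sin t` the convention `cot t = 0` agrees with the right side, so the integrand is
continuous everywhere. -/
lemma one_sub_cos_mul_cot (n : ℕ) (t : ℝ) :
    (1 - Real.cos (2 * (n : ℝ) * t)) * Real.cot t =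
      ∑ k ∈ Finset.range n, (Real.sin (2 * ((k + 1 : ℕ) : ℝ) * t) + Real.sin (2 * (k : ℝ) * t)) := by
  induction n with
  | zero => simp
  | succ n ih =>
    rw [Finset.sum_range_succ, ← ih, Real.cot_eq_cos_div_sin]
    have e1 : 2 * ((n + 1 : ℕ) : ℝ) * t = (2 * n + 1) * t + t := by push_cast; ring
    have e2 : 2 * (n : ℝ) * t = (2 * n + 1) * t - t := by ring
    rw [e1, e2, Real.sin_add, Real.sin_sub, Real.cos_add, Real.cos_sub]
    by_cases hs : Real.sin t = 0
    · have ha : Real.sin ((2 * n + 1) * t) = 0 := by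
        obtain ⟨m, hm⟩ := Real.sin_eq_zero_iff.1 hs
        rw [← hm, ← mul_assoc]
        exact_mod_cast Real.sin_int_mul_pi ((2 * n + 1) * m)
      rw [hs, ha]; simp
    · field_simp
      ring

lemma integral_sin_two_mul_nat (k : ℕ) :
    ∫ t in (0 : ℝ)..(Real.pi / 2), Real.sin (2 * (k : ℝ) * t) = oddReciprocal k := by
  rcases Nat.eq_zero_or_pos k with rfl | hk
  · simp [oddReciprocal]
  · have hk' : (2 * (k : ℝ)) ≠ 0 := by positivity
    rw [intervalIntegral.integral_comp_mul_left (fun x => Real.sin x) hk', integral_sin, mul_zero,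
      Real.cos_zero, show 2 * (k : ℝ) * (Real.pi / 2) = k * Real.pi by ring, Real.cos_nat_mul_pi,
      oddReciprocal, smul_eq_mul, inv_mul_eq_div]

lemma intervalIntegrable_one_sub_cos_mul_cot (n : ℕ) (a b : ℝ) :
    IntervalIntegrable (fun t : ℝ => (1 - Real.cos (2 * (n : ℝ) * t)) * Real.cot t) volume a b := by
  simp_rw [one_sub_cos_mul_cot]
  exact (by fun_prop : Continuous fun t : ℝ => ∑ k ∈ Finset.range n,
    (Real.sin (2 * ((k + 1 : ℕ) : ℝ) * t) + Real.sin (2 * (k : ℝ) * t))).intervalIntegrable _ _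

lemma integral_one_sub_cos_mul_cot (n : ℕ) :
    ∫ t in (0 : ℝ)..(Real.pi / 2), (1 - Real.cos (2 * (n : ℝ) * t)) * Real.cot t =
      neumannBeta n := by
  have hc : ∀ k : ℕ, IntervalIntegrable (fun t : ℝ => Real.sin (2 * (k : ℝ) * t)) volume
      0 (Real.pi / 2) := fun k => (by fun_prop : Continuous _).intervalIntegrable _ _
  simp_rw [one_sub_cos_mul_cot]
  rw [intervalIntegral.integral_finsetSum fun k _ => (hc (k + 1)).add (hc k), neumannBeta_eq_sum]
  refine Finset.sum_congr rfl fun k _ => ?_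
  rw [intervalIntegral.integral_add (hc (k + 1)) (hc k), integral_sin_two_mul_nat,
    integral_sin_two_mul_nat]

/-! ### Central factorials and the finite sum. -/

/-- The central factorial product `∏_{i<k} (x² - i²)`. -/
noncomputable def centralProd (k : ℕ) (x : ℝ) : ℝ := ∏ i ∈ Finset.range k, (x ^ 2 - (i : ℝ) ^ 2)

lemma centralProd_succ (k : ℕ) (x : ℝ) :
    centralProd (k + 1) x = centralProd k x * (x ^ 2 - (k : ℝ) ^ 2) := Finset.prod_range_succ _ _

lemma centralProd_eq_zero {k n : ℕ} (h : n < k) : centralProd k n = 0 :=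
  Finset.prod_eq_zero (Finset.mem_range.2 h) (sub_self _)

/-- The discrete analogue of `(x^(2k+2))'' = (2k+2)(2k+1) x^(2k)`; it makes the coefficients of `cos
2nt` satisfy the Chebyshev recursion in `n`. -/
lemma centralProd_second_difference (k : ℕ) (x : ℝ) :
    centralProd (k + 1) (x + 1) + centralProd (k + 1) (x - 1) - 2 * centralProd (k + 1) x =
      (2 * k + 2) * (2 * k + 1) * centralProd k x := by
  rcases k with _ | k
  · simp [centralProd]; ring
  -- `r = (x-k)⋯(x+k)` is the block of consecutive factors shared by all the products involved.
  set r : ℝ := x * ∏ i ∈ Finset.range k, (x ^ 2 - ((i : ℝ) + 1) ^ 2) with hr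
  have key : centralProd (k + 1) x = x * r ∧
      centralProd (k + 2) (x + 1) = (x + 1) * (x + k + 1) * (x + k + 2) * r ∧
      centralProd (k + 2) (x - 1) = (x - 1) * (x - k - 1) * (x - k - 2) * r := by
    rw [hr]
    clear hr r
    induction k with
    | zero => refine ⟨?_, ?_, ?_⟩ <;> simp [centralProd, Finset.prod_range_succ] <;> ring
    | succ k ih =>
      obtain ⟨h1, h2, h3⟩ := ih
      rw [centralProd_succ (k + 1) x, centralProd_succ (k + 2), centralProd_succ (k + 2), h1, h2,
        h3, Finset.prod_range_succ]
      push_cast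
      refine ⟨?_, ?_, ?_⟩ <;> ring
  obtain ⟨h1, h2, h3⟩ := key
  rw [h2, h3, centralProd_succ (k + 1) x, h1]
  push_cast
  ring

lemma centralProd_eq_factorial {n j : ℕ} (h : j < n) :
    centralProd (j + 1) n = n * (((n + j)! : ℝ) / ((n - j - 1)! : ℝ)) := by
  induction j with
  | zero =>
    obtain ⟨n, rfl⟩ := Nat.exists_eq_succ_of_ne_zero h.ne'
    simp [centralProd, Nat.factorial_succ]
    field_simp
  | succ j ih =>
    obtain ⟨d, rfl⟩ := Nat.exists_eq_add_of_lt h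
    rw [centralProd_succ, ih (by omega), show j + 1 + d + 1 - j - 1 = d + 1 by omega,
      show j + 1 + d + 1 - (j + 1) - 1 = d by omega, ← add_assoc, Nat.factorial_succ d,
      Nat.factorial_succ (j + 1 + d + 1 + j)]
    push_cast
    field_simp
    ring

/-- Expansion of `cos (2nt)` in even powers of `sin t`; the terms with `k > n` vanish. -/
lemma cos_two_mul_nat_eq_sum (t : ℝ) (n N : ℕ) (h : n ≤ N) :
    Real.cos (2 * (n : ℝ) * t) = ∑ k ∈ Finset.range (N + 1),
      (-4 : ℝ) ^ k / ((2 * k)! : ℝ) * centralProd k n * Real.sin t ^ (2 * k) := by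
  suffices H : ∀ n : ℕ, (∀ N, n ≤ N → Real.cos (2 * (n : ℝ) * t) = ∑ k ∈ Finset.range (N + 1),
      (-4 : ℝ) ^ k / ((2 * k)! : ℝ) * centralProd k n * Real.sin t ^ (2 * k)) ∧
      (∀ N, n + 1 ≤ N → Real.cos (2 * ((n + 1 : ℕ) : ℝ) * t) = ∑ k ∈ Finset.range (N + 1),
      (-4 : ℝ) ^ k / ((2 * k)! : ℝ) * centralProd k ((n + 1 : ℕ) : ℝ) * Real.sin t ^ (2 * k)) from
    (H n).1 N h
  intro n
  induction n with
  | zero =>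
    refine ⟨fun N _ => ?_, fun N hN => ?_⟩
    · rw [Finset.sum_eq_single 0 (fun k _ hk => ?_) (by simp)]
      · simp [centralProd]
      · rw [centralProd_eq_zero (Nat.pos_of_ne_zero hk)]; simp
    · obtain ⟨M, rfl⟩ := Nat.exists_eq_add_of_le' hN
      rw [Finset.sum_range_succ', Finset.sum_range_succ', Finset.sum_eq_zero fun k _ => ?_]
      · have := Real.cos_sq' t
        simp [centralProd, Real.cos_two_mul, this]
        ring
      · rw [centralProd_eq_zero (by omega)]; simp
  | succ n ih =>
    refine ⟨ih.2, fun N hN => ?_⟩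
    obtain ⟨M, rfl⟩ := Nat.exists_eq_add_of_le' (show 1 ≤ N by omega)
    -- Multiplication by `sin² t` shifts the index by one, so the expansion at `n + 1` is used with
    -- two lengths: `M + 1` for the unshifted term and `M` for the shifted one.
    have h1 := ih.1 (M + 1) (by omega)
    have h2 := ih.2 (M + 1) (by omega)
    have h3 := ih.2 M (by omega)
    have hrec : Real.cos (2 * ((n + 1 + 1 : ℕ) : ℝ) * t) =
        2 * (1 - 2 * Real.sin t ^ 2) * Real.cos (2 * ((n + 1 : ℕ) : ℝ) * t) -
          Real.cos (2 * (n : ℝ) * t) := by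
      have e1 : 2 * ((n + 1 + 1 : ℕ) : ℝ) * t = 2 * ((n + 1 : ℕ) : ℝ) * t + 2 * t := by
        push_cast; ring
      have e2 : 2 * (n : ℝ) * t = 2 * ((n + 1 : ℕ) : ℝ) * t - 2 * t := by push_cast; ring
      have := Real.cos_sq' t
      rw [e1, e2, Real.cos_add, Real.cos_sub, Real.cos_two_mul t]
      linear_combination (4 * Real.cos (2 * ((n + 1 : ℕ) : ℝ) * t)) * this
    rw [hrec, h1, mul_sub, sub_mul, mul_one]
    conv_lhs => enter [1, 1]; rw [h2]
    conv_lhs => enter [1, 2]; rw [h3]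
    rw [Finset.sum_range_succ' _ (M + 1), Finset.sum_range_succ' _ (M + 1),
      Finset.sum_range_succ' _ (M + 1)]
    have h0 : ∀ x, centralProd 0 x = 1 := fun x => by simp [centralProd]
    have hstep : ∀ k : ℕ, (-4 : ℝ) ^ (k + 1) / ((2 * (k + 1))! : ℝ) *
        centralProd (k + 1) ((n + 1 + 1 : ℕ) : ℝ) * Real.sin t ^ (2 * (k + 1)) =
        2 * ((-4 : ℝ) ^ (k + 1) / ((2 * (k + 1))! : ℝ) *
        centralProd (k + 1) ((n + 1 : ℕ) : ℝ) * Real.sin t ^ (2 * (k + 1))) -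
        2 * (2 * Real.sin t ^ 2) * ((-4 : ℝ) ^ k / ((2 * k)! : ℝ) *
        centralProd k ((n + 1 : ℕ) : ℝ) * Real.sin t ^ (2 * k)) -
        (-4 : ℝ) ^ (k + 1) / ((2 * (k + 1))! : ℝ) *
        centralProd (k + 1) (n : ℝ) * Real.sin t ^ (2 * (k + 1)) := fun k => by
      have hd := centralProd_second_difference k ((n + 1 : ℕ) : ℝ)
      rw [show ((n + 1 : ℕ) : ℝ) + 1 = ((n + 1 + 1 : ℕ) : ℝ) by push_cast; ring,
        show ((n + 1 : ℕ) : ℝ) - 1 = (n : ℝ) by push_cast; ring] at hd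
      rw [show centralProd (k + 1) ((n + 1 + 1 : ℕ) : ℝ) =
        (2 * k + 2) * (2 * k + 1) * centralProd k ((n + 1 : ℕ) : ℝ) - centralProd (k + 1) (n : ℝ) +
        2 * centralProd (k + 1) ((n + 1 : ℕ) : ℝ) by linarith, show 2 * (k + 1) = 2 * k + 1 + 1 by ring,
        Nat.factorial_succ (2 * k + 1), Nat.factorial_succ (2 * k)]
      push_cast
      field_simp
      ring
    rw [Finset.sum_congr rfl fun k (_ : k ∈ Finset.range (M + 1)) => hstep k,
      Finset.sum_sub_distrib, Finset.sum_sub_distrib, ← Finset.mul_sum, ← Finset.mul_sum]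
    simp only [h0]
    ring

lemma integral_sin_pow_mul_cot (k : ℕ) :
    ∫ t in (0 : ℝ)..(Real.pi / 2), Real.sin t ^ (2 * k + 1) * Real.cos t = 1 / (2 * k + 2) := by
  have := integral_sin_pow_mul_cos_pow_odd (a := 0) (b := Real.pi / 2) (2 * k + 1) 0
  simp only [mul_zero, zero_add, pow_one, pow_zero, mul_one, Real.sin_zero, Real.sin_pi_div_two,
    integral_pow] at this
  rw [this]
  push_cast
  ring

lemma neumannBeta_div_eq_sum {n : ℕ} (hn : 1 ≤ n) :
    neumannBeta n / (2 * (n : ℝ)) = ∑ j ∈ Finset.range n,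
      (-1 : ℝ) ^ j * 2 ^ (2 * j) / (((j : ℝ) + 1) * ((2 * j + 2)! : ℝ)) *
        (((n + j)! : ℝ) / ((n - j - 1)! : ℝ)) := by
  have hn0 : (n : ℝ) ≠ 0 := by positivity
  have hexp : ∀ t : ℝ, (1 - Real.cos (2 * (n : ℝ) * t)) * Real.cot t =
      ∑ j ∈ Finset.range n, 4 * (-4 : ℝ) ^ j / ((2 * j + 2)! : ℝ) * centralProd (j + 1) n *
        (Real.sin t ^ (2 * j + 1) * Real.cos t) := fun t => by
    rw [cos_two_mul_nat_eq_sum t n n le_rfl, Finset.sum_range_succ', Real.cot_eq_cos_div_sin]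
    have : centralProd 0 (n : ℝ) = 1 := by simp [centralProd]
    rw [this]
    simp only [pow_zero, mul_zero, Nat.factorial_zero, Nat.cast_one, div_one, mul_one,
      sub_add_cancel_right, neg_mul, Finset.sum_mul, ← Finset.sum_neg_distrib]
    refine Finset.sum_congr rfl fun j _ => ?_
    by_cases hs : Real.sin t = 0
    · simp [hs]
    · rw [show 2 * (j + 1) = 2 * j + 2 by ring]
      field_simp
      ring
  rw [← integral_one_sub_cos_mul_cot]
  simp_rw [hexp]
  rw [intervalIntegral.integral_finsetSum fun j _ =>
    (by fun_prop : Continuous _).intervalIntegrable _ _, Finset.sum_div]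
  refine Finset.sum_congr rfl fun j hj => ?_
  rw [intervalIntegral.integral_const_mul, integral_sin_pow_mul_cot,
    centralProd_eq_factorial (Finset.mem_range.1 hj), pow_mul, show (-4 : ℝ) = -1 * 4 by norm_num,
    mul_pow, show (2 : ℝ) ^ 2 = 4 by norm_num]
  field_simp
  ring

/-! ### The regularized cosine integral and Euler's constant. -/

/-- The function `(1 - cos u) / u`. -/
noncomputable def cinKernel (u : ℝ) : ℝ := (1 - Real.cos u) / u

/-- The regularized cosine integral `∫₀ᵗ (1 - cos u) / u du`. -/
noncomputable def cin (t : ℝ) : ℝ := ∫ u in (0 : ℝ)..t, cinKernel u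

lemma continuous_cinKernel : Continuous cinKernel := by
  have : cinKernel = fun u => u / 2 * Real.sinc (u / 2) ^ 2 := by
    funext u
    rcases eq_or_ne u 0 with rfl | hu
    · simp [cinKernel]
    · rw [cinKernel, Real.sinc_of_ne_zero (by positivity)]
      have h := Real.cos_sq' (u / 2)
      have h2 := Real.cos_two_mul (u / 2)
      rw [mul_div_cancel₀ u two_ne_zero] at h2
      rw [h2, h]
      field_simp
      ring
  rw [this]
  have := Real.continuous_sinc
  fun_prop

lemma cinKernel_nonneg {u : ℝ} (hu : 0 ≤ u) : 0 ≤ cinKernel u :=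
  div_nonneg (sub_nonneg.2 (Real.cos_le_one u)) hu

lemma cinKernel_le {u : ℝ} (hu : 0 < u) : cinKernel u ≤ 2 * u⁻¹ := by
  rw [cinKernel, div_eq_mul_inv]
  have := Real.neg_one_le_cos u
  gcongr
  linarith

lemma hasDerivAt_cin (t : ℝ) : HasDerivAt cin (cinKernel t) t :=
  intervalIntegral.integral_hasDerivAt_right (continuous_cinKernel.intervalIntegrable _ _)
    (continuous_cinKernel.stronglyMeasurableAtFilter _ _) continuous_cinKernel.continuousAt

lemma continuous_cin : Continuous cin :=
  continuous_iff_continuousAt.2 fun t => (hasDerivAt_cin t).continuousAt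

lemma cin_zero : cin 0 = 0 := intervalIntegral.integral_same

lemma cin_sub_cin (a b : ℝ) : cin a - cin b = ∫ u in b..a, cinKernel u :=
  intervalIntegral.integral_interval_sub_left (continuous_cinKernel.intervalIntegrable _ _)
    (continuous_cinKernel.intervalIntegrable _ _)

/-- Follows from `0 ≤ cinKernel u ≤ 2/u`. As `log (aR) - log (bR)` does not depend on `R`, it
provides the domination for the Frullani-type limit. -/
lemma abs_cin_sub_cin_le {a b : ℝ} (ha : 0 < a) (hb : 0 < b) :
    |cin a - cin b| ≤ 2 * |Real.log a - Real.log b| := by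
  wlog h : b ≤ a generalizing a b
  · rw [abs_sub_comm, abs_sub_comm (Real.log a)]
    exact this hb ha (le_of_not_ge h)
  have hu : ∀ u ∈ Icc b a, 0 < u := fun u hu => hb.trans_le hu.1
  rw [cin_sub_cin, abs_of_nonneg (intervalIntegral.integral_nonneg h fun u hu' =>
    cinKernel_nonneg (hu u hu').le), abs_of_nonneg (sub_nonneg.2 (Real.log_le_log hb h)),
    ← Real.log_div ha.ne' hb.ne', ← integral_inv_of_pos hb ha,
    ← intervalIntegral.integral_const_mul]
  refine intervalIntegral.integral_mono_on h (continuous_cinKernel.intervalIntegrable _ _) ?_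
    fun u hu' => cinKernel_le (hu u hu')
  refine (ContinuousOn.intervalIntegrable_of_Icc h ?_)
  exact continuousOn_const.mul (continuousOn_id.inv₀ fun u hu' => (hu u hu').ne')

lemma integral_mul_cinKernel_mul (a R : ℝ) :
    ∫ t in (0 : ℝ)..R, a * cinKernel (a * t) = cin (a * R) := by
  rw [intervalIntegral.integral_const_mul, intervalIntegral.mul_integral_comp_mul_left, mul_zero,
    cin]

/-- The Riemann–Lebesgue lemma for cosines on an interval. -/
lemma tendsto_integral_cos_mul {f : ℝ → ℝ} {b : ℝ} (hb : 0 ≤ b)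
    (hf : IntervalIntegrable f volume 0 b) :
    Tendsto (fun w : ℝ => ∫ t in (0 : ℝ)..b, Real.cos (w * t) * f t) atTop (𝓝 0) := by
  set g : ℝ → ℂ := (Ioc 0 b).indicator fun t => (f t : ℂ) with hg
  have hgi : Integrable g := by
    rw [hg, integrable_indicator_iff measurableSet_Ioc]
    exact ((intervalIntegrable_iff_integrableOn_Ioc_of_le hb).1 hf).ofReal
  have h := (Real.tendsto_integral_exp_smul_cocompact g).mono_left atTop_le_cocompact
  have h2 := (Complex.continuous_re.tendsto _).comp
    (h.comp (tendsto_id.atTop_div_const Real.two_pi_pos))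
  rw [Complex.zero_re] at h2
  refine h2.congr fun w => ?_
  simp only [Function.comp_apply, id]
  have hint : Integrable fun v : ℝ => Real.fourierChar (-(v * (w / (2 * Real.pi)))) • g v := by
    refine (hgi.norm.mono' ?_ (Eventually.of_forall fun v => (Circle.norm_smul _ _).le))
    exact (by fun_prop : Continuous fun v : ℝ =>
      Real.fourierChar (-(v * (w / (2 * Real.pi))))).aestronglyMeasurable.smul hgi.1
  rw [← Complex.reCLM_apply, ← ContinuousLinearMap.integral_comp_comm _ hint,
    intervalIntegral.integral_of_le hb, ← integral_indicator measurableSet_Ioc]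
  refine integral_congr_ae (Eventually.of_forall fun v => ?_)
  by_cases hv : v ∈ Ioc 0 b
  · have hpi := Real.pi_ne_zero
    have e : 2 * Real.pi * -(v * (w / (2 * Real.pi))) = -(w * v) := by field_simp
    simp only [hg, indicator_of_mem hv, Complex.reCLM_apply, Circle.smul_def, Real.fourierChar_apply,
      smul_eq_mul, Complex.re_mul_ofReal, e, Complex.exp_ofReal_mul_I_re, Real.cos_neg]
  · simp [hg, hv]

lemma hasDerivAt_neg_log_sinc {t : ℝ} (ht : t ∈ Ioo 0 (Real.pi / 2)) :
    HasDerivAt (fun t => -Real.log (Real.sinc t)) (t⁻¹ - Real.cot t) t := by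
  have hs : 0 < Real.sin t := Real.sin_pos_of_pos_of_lt_pi ht.1 (by linarith [ht.2, Real.pi_pos])
  have h : HasDerivAt (fun t => Real.log t - Real.log (Real.sin t))
      (t⁻¹ - Real.cos t / Real.sin t) t :=
    (Real.hasDerivAt_log ht.1.ne').sub ((Real.hasDerivAt_sin t).log hs.ne')
  rw [Real.cot_eq_cos_div_sin]
  refine h.congr_of_eventuallyEq ?_
  have hs' : ∀ᶠ u in 𝓝 t, 0 < Real.sin u := Real.continuous_sin.continuousAt.eventually_const_lt hs
  filter_upwards [hs', lt_mem_nhds ht.1] with u hu hu0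
  rw [Real.sinc_of_ne_zero (ne_of_gt hu0), Real.log_div hu.ne' (ne_of_gt hu0)]
  ring

lemma sinc_pos {t : ℝ} (ht : t ∈ Icc 0 (Real.pi / 2)) : 0 < Real.sinc t := by
  rcases ht.1.eq_or_lt with h | h
  · rw [← h]; simp
  · rw [Real.sinc_of_ne_zero h.ne']
    exact div_pos (Real.sin_pos_of_pos_of_lt_pi h (by linarith [ht.2, Real.pi_pos])) h

lemma continuousOn_neg_log_sinc :
    ContinuousOn (fun t => -Real.log (Real.sinc t)) (Icc 0 (Real.pi / 2)) :=
  (Real.continuous_sinc.continuousOn.log fun _ ht => (sinc_pos ht).ne').neg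

/-- A nonnegative derivative (`t < tan t`) of a function continuous up to the endpoints is
integrable, so no bound near `0` is needed. -/
lemma intervalIntegrable_inv_sub_cot :
    IntervalIntegrable (fun t : ℝ => t⁻¹ - Real.cot t) volume 0 (Real.pi / 2) := by
  rw [intervalIntegrable_iff_integrableOn_Ioc_of_le (by positivity)]
  refine intervalIntegral.integrableOn_deriv_of_nonneg continuousOn_neg_log_sinc
    (fun t ht => hasDerivAt_neg_log_sinc ht) fun t ht => ?_
  have h := Real.lt_tan ht.1 ht.2
  rw [sub_nonneg, ← Real.tan_inv_eq_cot]
  exact inv_anti₀ ht.1 h.le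

lemma integral_inv_sub_cot :
    ∫ t in (0 : ℝ)..(Real.pi / 2), (t⁻¹ - Real.cot t) = Real.log (Real.pi / 2) := by
  rw [intervalIntegral.integral_eq_sub_of_hasDerivAt_of_le (by positivity)
    continuousOn_neg_log_sinc (fun t ht => hasDerivAt_neg_log_sinc ht)
    intervalIntegrable_inv_sub_cot, Real.sinc_zero, Real.sinc_of_ne_zero (by positivity),
    Real.sin_pi_div_two, one_div, Real.log_inv]
  simp

/-- After rescaling, `cin (nπ) = ∫ (1 - cos 2nt)/t` over `[0, π/2]`; split `1/t = cot t + (1/t - cot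
t)`. The last integral tends to zero by Riemann–Lebesgue. -/
lemma cin_nat_mul_pi {n : ℕ} (hn : n ≠ 0) :
    cin (n * Real.pi) = neumannBeta n + Real.log (Real.pi / 2) -
      ∫ t in (0 : ℝ)..(Real.pi / 2), Real.cos (2 * n * t) * (t⁻¹ - Real.cot t) := by
  have hcos : IntervalIntegrable (fun t : ℝ => Real.cos (2 * n * t) * (t⁻¹ - Real.cot t)) volume
      0 (Real.pi / 2) :=
    intervalIntegrable_inv_sub_cot.continuousOn_mul (by fun_prop)
  rw [← integral_one_sub_cos_mul_cot, ← integral_inv_sub_cot,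
    ← intervalIntegral.integral_add (intervalIntegrable_one_sub_cos_mul_cot _ _ _)
      intervalIntegrable_inv_sub_cot, ← intervalIntegral.integral_sub
      ((intervalIntegrable_one_sub_cos_mul_cot _ _ _).add intervalIntegrable_inv_sub_cot) hcos,
    show (n : ℝ) * Real.pi = 2 * n * (Real.pi / 2) by ring, ← integral_mul_cinKernel_mul]
  refine intervalIntegral.integral_congr fun t _ => ?_
  have hn' : (n : ℝ) ≠ 0 := by exact_mod_cast hn
  simp only [cinKernel]
  field_simp
  ring

lemma altHarmonic_two_mul (m : ℕ) :
    altHarmonic (2 * m) = (harmonic (2 * m) : ℝ) - (harmonic m : ℝ) := by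
  induction m with
  | zero => simp [altHarmonic]
  | succ m ih =>
    have h : altHarmonic (2 * (m + 1)) = altHarmonic (2 * m) + 1 / (2 * m + 1) - 1 / (2 * m + 2) := by
      rw [altHarmonic, show 2 * (m + 1) = 2 * m + 1 + 1 by ring, Finset.sum_Icc_succ_top (by omega),
        Finset.sum_Icc_succ_top (by omega), ← altHarmonic]
      simp [pow_succ, pow_mul]
      ring
    rw [h, ih, show 2 * (m + 1) = 2 * m + 1 + 1 by ring, harmonic_succ, harmonic_succ,
      harmonic_succ]
    push_cast
    field_simp
    ring

lemma neumannBeta_two_mul (m : ℕ) :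
    neumannBeta (2 * m) = 2 * (harmonic (2 * m) : ℝ) - (harmonic m : ℝ) := by
  rcases m with _ | m
  · simp [neumannBeta_zero]
  · rw [neumannBeta, altHarmonic_two_mul, show 2 * (m + 1) - 1 = 2 * m + 1 by omega, pow_succ,
      pow_mul, neg_one_sq, one_pow]
    push_cast
    field_simp
    ring

lemma exists_tendsto_cin_sub_log :
    ∃ c, Tendsto (fun x => cin x - Real.log x) atTop (𝓝 c) := by
  -- Adding `sin x / x` is an integration by parts: it replaces the conditionally integrable
  -- derivative `-cos x / x` by `-sin x / x²`.
  have hd : ∀ x ∈ Ioi (1 : ℝ), HasDerivAt (fun x => cin x - Real.log x + Real.sin x * x⁻¹)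
      (-(Real.sin x / x ^ 2)) x := fun x hx => by
    have hx0 : x ≠ 0 := (zero_lt_one.trans (mem_Ioi.1 hx)).ne'
    refine (((hasDerivAt_cin x).sub (Real.hasDerivAt_log hx0)).add
      ((Real.hasDerivAt_sin x).mul (hasDerivAt_inv hx0))).congr_deriv ?_
    rw [cinKernel]
    field_simp
    ring
  have hi : IntegrableOn (fun x : ℝ => -(Real.sin x / x ^ 2)) (Ioi 1) := by
    have h1 : IntegrableOn (fun x : ℝ => x ^ (-2 : ℝ)) (Ioi 1) :=
      integrableOn_Ioi_rpow_of_lt (by norm_num) one_pos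
    refine Integrable.mono' h1
      (Real.measurable_sin.div (measurable_id.pow_const 2)).neg.aestronglyMeasurable ?_
    filter_upwards [ae_restrict_mem measurableSet_Ioi] with x hx
    have hx0 : (0 : ℝ) < x := zero_lt_one.trans hx
    rw [Real.rpow_neg hx0.le, norm_neg, norm_div, Real.norm_eq_abs,
      Real.norm_of_nonneg (by positivity : 0 ≤ x ^ 2), div_eq_mul_inv]
    norm_cast
    exact mul_le_of_le_one_left (by positivity) (Real.abs_sin_le_one x)
  have h := tendsto_limUnder_of_hasDerivAt_of_integrableOn_Ioi hd hi
  have h0 : Tendsto (fun x : ℝ => Real.sin x * x⁻¹) atTop (𝓝 0) := by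
    refine tendsto_inv_atTop_zero.zero_mul_isBoundedUnder_le ?_ |>.congr fun x => mul_comm _ _
    exact isBoundedUnder_of ⟨1, fun x => Real.abs_sin_le_one x⟩
  refine ⟨_, (h.sub h0).congr fun x => ?_⟩
  ring

/-- The limit exists, so it is read off along `x = 2mπ`. There `β_{2m} = 2 H_{2m} - H_m`, whose
asymptotics contribute `2γ - γ`, and the logarithms cancel exactly. -/
lemma tendsto_cin_sub_log :
    Tendsto (fun x => cin x - Real.log x) atTop (𝓝 Real.eulerMascheroniConstant) := by
  obtain ⟨c, hc⟩ := exists_tendsto_cin_sub_log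
  have h2 : Tendsto (fun m : ℕ => 2 * m) atTop atTop :=
    tendsto_id.const_mul_atTop' two_pos
  have hseq : Tendsto (fun m : ℕ => ((2 * m : ℕ) : ℝ) * Real.pi) atTop atTop :=
    (tendsto_natCast_atTop_atTop.comp h2).atTop_mul_const Real.pi_pos
  have hrl := (tendsto_integral_cos_mul (by positivity) intervalIntegrable_inv_sub_cot).comp
    ((tendsto_natCast_atTop_atTop (R := ℝ)).comp h2 |>.const_mul_atTop two_pos)
  have hlim := (((Real.tendsto_harmonic_sub_log.comp h2).const_mul 2).sub
    Real.tendsto_harmonic_sub_log).sub hrl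
  have hval : 2 * Real.eulerMascheroniConstant - Real.eulerMascheroniConstant - 0 =
    Real.eulerMascheroniConstant := by ring
  rw [hval] at hlim
  suffices c = Real.eulerMascheroniConstant from this ▸ hc
  refine tendsto_nhds_unique (hc.comp hseq) (hlim.congr' ?_)
  filter_upwards [eventually_ne_atTop 0] with m hm
  have hm' : (m : ℝ) ≠ 0 := by exact_mod_cast hm
  have hpi := Real.pi_ne_zero
  simp only [Function.comp_apply]
  rw [cin_nat_mul_pi (by omega), neumannBeta_two_mul, Real.log_mul (by positivity) hpi,
    Real.log_div hpi two_ne_zero, Nat.cast_mul, Nat.cast_two, Real.log_mul two_ne_zero hm']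
  ring

lemma cosineIntegral_eq {t : ℝ} (ht : 0 < t) :
    cosineIntegral t = Real.eulerMascheroniConstant + Real.log t - cin t := by
  have h : Tendsto (fun R : ℝ => ∫ u in t..R, Real.cos u / u) atTop
      (𝓝 (cin t - Real.log t - Real.eulerMascheroniConstant)) := by
    refine (tendsto_cin_sub_log.const_sub (cin t - Real.log t)).congr' ?_
    filter_upwards [eventually_ge_atTop t] with R hR
    rw [intervalIntegral.integral_eq_sub_of_hasDerivAt (f := fun x => Real.log x - cin x)]
    · ring
    · intro u hu
      rw [uIcc_of_le hR] at hu
      have hu0 : u ≠ 0 := (ht.trans_le hu.1).ne'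
      refine ((Real.hasDerivAt_log hu0).sub (hasDerivAt_cin u)).congr_deriv ?_
      rw [cinKernel]
      field_simp
      ring
    · refine ContinuousOn.intervalIntegrable ?_
      rw [uIcc_of_le hR]
      exact Real.continuous_cos.continuousOn.div continuousOn_id fun u hu => (ht.trans_le hu.1).ne'
  rw [cosineIntegral, h.limUnder_eq]
  ring

/-! ### Absolute convergence of the Bessel integrals. -/

lemma cin_isBigO : cin =O[atTop] fun t : ℝ => t ^ (1 / 4 : ℝ) := by
  have h1 := (tendsto_cin_sub_log.isBigO_one ℝ)
  have h2 : (fun _ : ℝ => (1 : ℝ)) =O[atTop] fun t : ℝ => t ^ (1 / 4 : ℝ) :=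
    ((Asymptotics.isLittleO_const_left.2 (Or.inr (tendsto_norm_atTop_atTop.comp
      (tendsto_rpow_atTop (by norm_num)))))).isBigO
  have h3 := (isLittleO_log_rpow_atTop (by norm_num : (0 : ℝ) < 1 / 4)).isBigO
  exact ((h1.trans h2).add h3).congr_left fun x => by ring

lemma integrableOn_Ioi_of_continuous_of_isBigO {f : ℝ → ℝ} (hf : Continuous f)
    (ho : f =O[atTop] fun t : ℝ => t ^ (-(5 / 4) : ℝ)) : IntegrableOn f (Ioi 0) :=
  ((hf.locallyIntegrable.locallyIntegrableOn (Ici 0)).integrableOn_of_isBigO_atTop ho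
    (integrableAtFilter_rpow_atTop_iff.2 (by norm_num))).mono_set Ioi_subset_Ici_self

lemma isBigO_rpow_mul {f g : ℝ → ℝ} {a b : ℝ} (hf : f =O[atTop] fun t : ℝ => t ^ a)
    (hg : g =O[atTop] fun t : ℝ => t ^ b) :
    (fun t => f t * g t) =O[atTop] fun t : ℝ => t ^ (a + b) := by
  refine (hf.mul hg).congr' EventuallyEq.rfl ?_
  filter_upwards [eventually_gt_atTop 0] with t ht
  rw [Real.rpow_add ht]

lemma inv_isBigO_rpow : (fun t : ℝ => t⁻¹) =O[atTop] fun t : ℝ => t ^ (-1 : ℝ) := by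
  simp_rw [Real.rpow_neg_one]
  exact Asymptotics.isBigO_refl _ _

lemma isBigO_rpow_of_bounded {f : ℝ → ℝ} {C : ℝ} (hf : ∀ t, |f t| ≤ C) :
    f =O[atTop] fun t : ℝ => t ^ (1 / 4 : ℝ) := by
  have h1 : f =O[atTop] fun _ : ℝ => (1 : ℝ) :=
    Asymptotics.IsBigO.of_bound C (Eventually.of_forall fun t => by simpa using hf t)
  refine h1.trans (Asymptotics.isLittleO_const_left.2 (Or.inr (tendsto_norm_atTop_atTop.comp
    (tendsto_rpow_atTop (by norm_num))))).isBigO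

/-- The recurrence replaces `J_{m+1}(t)/t` by `(J_m + J_{m+2})/(2(m+1))`, continuous at `0`; at
infinity the exponents add up to `1/4 - 1/2 - 1 = -5/4`. -/
lemma integrableOn_mul_besselJ_div {f : ℝ → ℝ} (hf : Continuous f)
    (ho : f =O[atTop] fun t : ℝ => t ^ (1 / 4 : ℝ)) (m : ℕ) :
    IntegrableOn (fun t => f t * besselJ (m + 1) t / t) (Ioi 0) := by
  have heq : ∀ t : ℝ, t ≠ 0 → f t * ((besselJ m t + besselJ (m + 2) t) / (2 * (m + 1))) =
      f t * besselJ (m + 1) t / t := fun t ht => by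
    have h := besselJ_recurrence m t
    have : (2 * ((m : ℝ) + 1)) ≠ 0 := by positivity
    rw [mul_div_assoc]
    congr 1
    rw [div_eq_div_iff this ht]
    linarith
  refine (integrableOn_Ioi_of_continuous_of_isBigO (f := fun t =>
    f t * ((besselJ m t + besselJ (m + 2) t) / (2 * (m + 1)))) ?_ ?_).congr_fun
    (fun t ht => heq t (ne_of_gt ht)) measurableSet_Ioi
  · exact hf.mul (((continuous_besselJ m).add (continuous_besselJ (m + 2))).div_const _)
  · have h := isBigO_rpow_mul (isBigO_rpow_mul ho (besselJ_isBigO (m + 1))) inv_isBigO_rpow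
    rw [show (1 / 4 + -(1 / 2) + -1 : ℝ) = -(5 / 4) by norm_num] at h
    refine h.congr' ?_ EventuallyEq.rfl
    filter_upwards [eventually_ne_atTop 0] with t ht
    rw [heq t ht, div_eq_mul_inv]

/-- The factor `m` lets the recursions start at order zero, where `f * J₀ / t` need not be
integrable. -/
lemma integrableOn_natCast_mul_besselJ_div {f : ℝ → ℝ} (hf : Continuous f)
    (ho : f =O[atTop] fun t : ℝ => t ^ (1 / 4 : ℝ)) (m : ℕ) :
    IntegrableOn (fun t => (m : ℝ) * (f t * besselJ m t / t)) (Ioi 0) := by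
  rcases m with _ | m
  · simp
  · exact (integrableOn_mul_besselJ_div hf ho m).const_mul _

lemma integrableOn_cinKernel_mul_besselJ (m : ℕ) :
    IntegrableOn (fun t => cinKernel t * besselJ m t) (Ioi 0) := by
  refine integrableOn_Ioi_of_continuous_of_isBigO (continuous_cinKernel.mul (continuous_besselJ m)) ?_
  have h1 : (fun t => 1 - Real.cos t) =O[atTop] fun t : ℝ => t ^ (1 / 4 : ℝ) :=
    isBigO_rpow_of_bounded (C := 2) fun t => by
      rw [abs_le]; constructor <;> linarith [Real.neg_one_le_cos t, Real.cos_le_one t]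
  have h := isBigO_rpow_mul (isBigO_rpow_mul h1 inv_isBigO_rpow) (besselJ_isBigO m)
  rw [show (1 / 4 + -1 + -(1 / 2) : ℝ) = -(5 / 4) by norm_num] at h
  exact h

/-! ### Recursions in the order, from explicit primitives. -/

lemma hasDerivAt_besselJ_raise (m : ℕ) {x : ℝ} (hx : x ≠ 0) :
    HasDerivAt (besselJ m) (m * (besselJ m x / x) - besselJ (m + 1) x) x := by
  rcases m with _ | m
  · simpa using hasDerivAt_besselJ_zero x
  · refine (hasDerivAt_besselJ_succ m x).congr_deriv ?_
    have := besselJ_recurrence m x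
    push_cast
    field_simp
    linarith

lemma hasDerivAt_besselJ_lower (m : ℕ) {x : ℝ} (hx : x ≠ 0) :
    HasDerivAt (besselJ (m + 1)) (besselJ m x - ((m + 1 : ℕ) : ℝ) * (besselJ (m + 1) x / x)) x := by
  refine (hasDerivAt_besselJ_succ m x).congr_deriv ?_
  have := besselJ_recurrence m x
  push_cast
  field_simp
  linarith

lemma integral_natCast_mul (f : ℝ → ℝ) (m : ℕ) :
    ∫ t in Ioi (0 : ℝ), (m : ℝ) * (f t * besselJ m t / t) =
      m * ∫ t in Ioi (0 : ℝ), f t * besselJ m t / t := integral_const_mul _ _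

lemma cos_isBigO : Real.cos =O[atTop] fun t : ℝ => t ^ (1 / 4 : ℝ) :=
  isBigO_rpow_of_bounded (C := 1) Real.abs_cos_le_one

lemma one_isBigO : (fun _ : ℝ => (1 : ℝ)) =O[atTop] fun t : ℝ => t ^ (1 / 4 : ℝ) :=
  isBigO_rpow_of_bounded (C := 1) fun _ => by simp

lemma integral_cos_mul_besselJ_div_step (m : ℕ) :
    ((m + 2 : ℕ) : ℝ) * (∫ t in Ioi (0 : ℝ), Real.cos t * besselJ (m + 2) t / t) +
      m * (∫ t in Ioi (0 : ℝ), Real.cos t * besselJ m t / t) = -besselJ m 0 := by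
  have hi := integrableOn_natCast_mul_besselJ_div Real.continuous_cos cos_isBigO
  rw [← integral_natCast_mul, ← integral_natCast_mul, ← integral_add (hi _) (hi _)]
  -- The `sin` term is chosen so that its derivative cancels both the `J_{m+1}` terms and the `sin`
  -- terms produced by the first summand.
  rw [integral_Ioi_of_hasDerivAt_of_tendsto (m := 0) (f := fun t =>
    Real.cos t * (besselJ m t - besselJ (m + 2) t) + 2 * (Real.sin t * besselJ (m + 1) t))]
  · simp [besselJ_zero]
  · have h := continuous_besselJ
    exact (((Real.continuous_cos.mul ((h _).sub (h _))).add
      ((Real.continuous_sin.mul (h _)).const_mul 2))).continuousWithinAt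
  · intro t ht
    have ht0 : t ≠ 0 := ne_of_gt ht
    refine (((Real.hasDerivAt_cos t).mul ((hasDerivAt_besselJ_raise m ht0).sub
      (hasDerivAt_besselJ_lower (m + 1) ht0))).add
      (((Real.hasDerivAt_sin t).mul (hasDerivAt_besselJ_succ m t)).const_mul 2)).congr_deriv ?_
    simp only [Pi.sub_apply]
    ring
  · exact (hi _).add (hi _)
  · have hb : ∀ m (f : ℝ → ℝ), (∀ x, |f x| ≤ 1) →
        Tendsto (fun t => f t * besselJ m t) atTop (𝓝 0) := fun m f hf =>
      ((tendsto_besselJ_atTop m).zero_mul_isBoundedUnder_le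
        (isBoundedUnder_of ⟨1, fun x => hf x⟩)).congr fun x => mul_comm _ _
    have h := ((hb m _ Real.abs_cos_le_one).sub (hb (m + 2) _ Real.abs_cos_le_one)).add
      ((hb (m + 1) _ Real.abs_sin_le_one).const_mul 2)
    simp only [sub_zero, mul_zero, add_zero] at h
    exact h.congr fun t => by ring

lemma integral_besselJ_div_step (m : ℕ) :
    ((m + 2 : ℕ) : ℝ) * (∫ t in Ioi (0 : ℝ), 1 * besselJ (m + 2) t / t) -
      m * (∫ t in Ioi (0 : ℝ), 1 * besselJ m t / t) = besselJ m 0 := by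
  have hi := integrableOn_natCast_mul_besselJ_div continuous_const one_isBigO
  rw [← integral_natCast_mul (fun _ => 1), ← integral_natCast_mul (fun _ => 1),
    ← integral_sub (hi _) (hi _)]
  rw [integral_Ioi_of_hasDerivAt_of_tendsto (m := 0)
    (f := fun t => -(besselJ m t + besselJ (m + 2) t))]
  · simp [besselJ_zero]
  · exact ((continuous_besselJ m).add (continuous_besselJ (m + 2))).neg.continuousWithinAt
  · intro t ht
    have ht0 : t ≠ 0 := ne_of_gt ht
    refine ((hasDerivAt_besselJ_raise m ht0).add
      (hasDerivAt_besselJ_lower (m + 1) ht0)).neg.congr_deriv ?_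
    ring
  · exact (hi _).sub (hi _)
  · simpa using ((tendsto_besselJ_atTop m).add (tendsto_besselJ_atTop (m + 2))).neg

lemma integral_cin_mul_besselJ_div_step (m : ℕ) :
    ((m + 2 : ℕ) : ℝ) * (∫ t in Ioi (0 : ℝ), cin t * besselJ (m + 2) t / t) -
      m * (∫ t in Ioi (0 : ℝ), cin t * besselJ m t / t) =
      (∫ t in Ioi (0 : ℝ), cinKernel t * besselJ m t) +
        ∫ t in Ioi (0 : ℝ), cinKernel t * besselJ (m + 2) t := by
  have hi := integrableOn_natCast_mul_besselJ_div continuous_cin cin_isBigO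
  have hk := integrableOn_cinKernel_mul_besselJ
  have hlim : ∀ m, Tendsto (fun t => cin t * besselJ m t) atTop (𝓝 0) := fun m => by
    have h := isBigO_rpow_mul cin_isBigO (besselJ_isBigO m)
    rw [show (1 / 4 + -(1 / 2) : ℝ) = -(1 / 4) by norm_num] at h
    exact h.trans_tendsto (tendsto_rpow_neg_atTop (by norm_num))
  have hA : IntegrableOn (fun t => cinKernel t * besselJ m t + cinKernel t * besselJ (m + 2) t)
      (Ioi 0) := (hk m).add (hk (m + 2))
  have hB : IntegrableOn (fun t => ((m + 2 : ℕ) : ℝ) * (cin t * besselJ (m + 2) t / t) -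
      (m : ℝ) * (cin t * besselJ m t / t)) (Ioi 0) := (hi (m + 2)).sub (hi m)
  rw [← integral_natCast_mul, ← integral_natCast_mul, ← integral_sub (hi _) (hi _),
    ← integral_add (hk _) (hk _), eq_comm, ← sub_eq_zero, ← integral_sub hA hB]
  rw [integral_Ioi_of_hasDerivAt_of_tendsto (m := 0)
    (f := fun t => cin t * (besselJ m t + besselJ (m + 2) t))]
  · simp [cin_zero]
  · exact (continuous_cin.mul
      ((continuous_besselJ m).add (continuous_besselJ (m + 2)))).continuousWithinAt
  · intro t ht
    have ht0 : t ≠ 0 := ne_of_gt ht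
    refine ((hasDerivAt_cin t).mul ((hasDerivAt_besselJ_raise m ht0).add
      (hasDerivAt_besselJ_lower (m + 1) ht0))).congr_deriv ?_
    simp only [Pi.add_apply]
    ring
  · exact hA.sub hB
  · have h := (hlim m).add (hlim (m + 2))
    rw [add_zero] at h
    exact h.congr fun t => by ring

lemma integral_cos_mul_besselJ_div (n : ℕ) :
    ((2 * (n + 1) : ℕ) : ℝ) * (∫ t in Ioi (0 : ℝ), Real.cos t * besselJ (2 * (n + 1)) t / t) =
      (-1) ^ (n + 1) := by
  induction n with
  | zero => simpa [besselJ_zero] using integral_cos_mul_besselJ_div_step 0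
  | succ n ih =>
    have h := integral_cos_mul_besselJ_div_step (2 * (n + 1))
    rw [ih, besselJ_zero, if_neg (by omega)] at h
    rw [show 2 * (n + 1 + 1) = 2 * (n + 1) + 2 by ring, pow_succ]
    linarith

lemma integral_besselJ_div (n : ℕ) :
    ((2 * (n + 1) : ℕ) : ℝ) * (∫ t in Ioi (0 : ℝ), 1 * besselJ (2 * (n + 1)) t / t) = 1 := by
  induction n with
  | zero => simpa [besselJ_zero] using integral_besselJ_div_step 0
  | succ n ih =>
    have h := integral_besselJ_div_step (2 * (n + 1))
    rw [ih, besselJ_zero, if_neg (by omega)] at h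
    rw [show 2 * (n + 1 + 1) = 2 * (n + 1) + 2 by ring]
    linarith

/-! ### The integral of `(1 - cos t)/t` against `J₀`. -/

lemma integral_log_cos_zero_pi :
    ∫ θ in (0 : ℝ)..Real.pi, Real.log (Real.cos θ) = ∫ θ in (0 : ℝ)..Real.pi, Real.log (Real.sin θ) := by
  have hp : Function.Periodic (fun x => Real.log (Real.sin x)) Real.pi := fun x => by
    simp only [Real.sin_add_pi, Real.log_neg_eq_log]
  have h := hp.intervalIntegral_add_eq (Real.pi / 2) 0
  rw [zero_add] at h
  rw [← h]
  simp_rw [← Real.sin_add_pi_div_two]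
  rw [intervalIntegral.integral_comp_add_right (fun x => Real.log (Real.sin x)), zero_add,
    add_comm Real.pi]

lemma integral_cinKernel_mul_cos (R s : ℝ) :
    ∫ t in (0 : ℝ)..R, cinKernel t * Real.cos (t * s) =
      (cin ((1 + s) * R) + cin ((1 - s) * R)) / 2 - cin (s * R) := by
  have hc : ∀ a : ℝ, IntervalIntegrable (fun t => a * cinKernel (a * t)) volume 0 R := fun a =>
    (continuous_const.mul (continuous_cinKernel.comp (continuous_const_mul a))).intervalIntegrable
      _ _
  rw [← integral_mul_cinKernel_mul, ← integral_mul_cinKernel_mul, ← integral_mul_cinKernel_mul,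
    ← intervalIntegral.integral_add (hc _) (hc _), ← intervalIntegral.integral_div,
    ← intervalIntegral.integral_sub (((hc _).add (hc _)).div_const 2) (hc _)]
  refine intervalIntegral.integral_congr fun t _ => ?_
  have h : ∀ a : ℝ, a * cinKernel (a * t) = (1 - Real.cos (a * t)) / t := fun a => by
    rcases eq_or_ne a 0 with rfl | ha
    · simp
    · rw [cinKernel, ← mul_div_assoc, mul_div_mul_left _ _ ha]
  simp only [h]
  rw [cinKernel, show (1 + s) * t = t + t * s by ring, show (1 - s) * t = t - t * s by ring,
    mul_comm s t, Real.cos_add, Real.cos_sub]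
  ring

/-- Insert the integral representation of `J₀` up to `R` and swap. As `R → ∞` the three Euler
constants cancel and the inner integral tends to `log |cos θ| - log sin θ`, whose integral over `[0,
π]` is zero. -/
lemma integral_cinKernel_mul_besselJ_zero :
    ∫ t in Ioi (0 : ℝ), cinKernel t * besselJ 0 t = 0 := by
  set Φ : ℝ → ℝ → ℝ := fun R θ => (cin ((1 + Real.sin θ) * R) + cin ((1 - Real.sin θ) * R)) / 2 -
    cin (Real.sin θ * R) with hΦ
  have hswap : ∀ R : ℝ, ∫ t in (0 : ℝ)..R, cinKernel t * besselJ 0 t =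
      1 / Real.pi * ∫ θ in (0 : ℝ)..Real.pi, Φ R θ := fun R => by
    simp_rw [hΦ, ← integral_cinKernel_mul_cos]
    rw [← intervalIntegral_intervalIntegral_swap, ← intervalIntegral.integral_const_mul]
    · refine intervalIntegral.integral_congr fun t _ => ?_
      simp only [besselJ_zero_eq_integral, intervalIntegral.integral_const_mul]
      ring
    · have hcont : Continuous (Function.uncurry fun t θ : ℝ =>
          cinKernel t * Real.cos (t * Real.sin θ)) := by
        have := continuous_cinKernel
        fun_prop
      exact (hcont.continuousOn.integrableOn_compact (μ := volume)
        (isCompact_uIcc.prod isCompact_uIcc)).mono_set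
        (prod_mono uIoc_subset_uIcc uIoc_subset_uIcc)
  have hs : IntervalIntegrable (fun θ => Real.log (Real.sin θ)) volume 0 Real.pi :=
    intervalIntegrable_log_sin
  have hc : IntervalIntegrable (fun θ => Real.log (Real.cos θ)) volume 0 Real.pi :=
    intervalIntegrable_log_cos
  have hsin : ∀ᵐ θ : ℝ, θ ∈ uIoc 0 Real.pi →
      0 < Real.sin θ ∧ 0 < 1 - Real.sin θ ∧ Real.cos θ ≠ 0 := by
    filter_upwards [Measure.ae_ne volume (Real.pi / 2), Measure.ae_ne volume Real.pi]
      with θ h1 h2 hθ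
    rw [uIoc_of_le Real.pi_pos.le] at hθ
    have hlt : θ < Real.pi := lt_of_le_of_ne hθ.2 h2
    have hs := Real.sin_pos_of_pos_of_lt_pi hθ.1 hlt
    have hc : Real.cos θ ≠ 0 := fun hc => h1 <|
      Real.injOn_cos ⟨hθ.1.le, hθ.2⟩ ⟨by positivity, by linarith [Real.pi_pos]⟩
        (by rw [hc, Real.cos_pi_div_two])
    refine ⟨hs, ?_, hc⟩
    have := Real.sin_sq_add_cos_sq θ
    have := sq_pos_of_ne_zero hc
    nlinarith
  -- `cos θ` is negative past `π/2`; the identity persists because `Real.log` depends only on the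
  -- absolute value.
  have hlog : ∀ θ : ℝ, 0 < Real.sin θ → 0 < 1 - Real.sin θ →
      Real.log (1 + Real.sin θ) + Real.log (1 - Real.sin θ) = 2 * Real.log (Real.cos θ) :=
    fun θ hs h1 => by
      rw [← Real.log_mul (by positivity) h1.ne', ← Nat.cast_two, ← Real.log_pow]
      congr 1
      rw [Real.cos_sq']
      ring
  have hdct : Tendsto (fun R => ∫ θ in (0 : ℝ)..Real.pi, Φ R θ) atTop
      (𝓝 (∫ θ in (0 : ℝ)..Real.pi, (Real.log (Real.cos θ) - Real.log (Real.sin θ)))) := by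
    refine intervalIntegral.tendsto_integral_filter_of_dominated_convergence
      (fun θ => 2 + 2 * |Real.log (Real.cos θ)| + 2 * |Real.log (Real.sin θ)|) ?_ ?_ ?_ ?_
    · refine Eventually.of_forall fun R => ?_
      have := continuous_cin
      exact (by fun_prop : Continuous (Φ R)).aestronglyMeasurable
    · filter_upwards [eventually_gt_atTop 0] with R hR
      filter_upwards [hsin] with θ hθ hmem
      obtain ⟨hs, h1, -⟩ := hθ hmem
      have ha := abs_cin_sub_cin_le (mul_pos (by linarith : 0 < 1 + Real.sin θ) hR) (mul_pos hs hR)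
      have hb := abs_cin_sub_cin_le (mul_pos h1 hR) (mul_pos hs hR)
      rw [Real.log_mul (by positivity) hR.ne', Real.log_mul hs.ne' hR.ne', add_sub_add_right_eq_sub]
        at ha
      rw [Real.log_mul h1.ne' hR.ne', Real.log_mul hs.ne' hR.ne', add_sub_add_right_eq_sub] at hb
      have hl0 : 0 ≤ Real.log (1 + Real.sin θ) := Real.log_nonneg (by linarith)
      have hl1 : Real.log (1 + Real.sin θ) ≤ 1 := by
        have := Real.log_le_sub_one_of_pos (by linarith : 0 < 1 + Real.sin θ)
        linarith
      have hl := hlog θ hs h1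
      have e1 : |Real.log (1 + Real.sin θ) - Real.log (Real.sin θ)| ≤ 1 + |Real.log (Real.sin θ)| :=
        (abs_sub _ _).trans (by rw [abs_of_nonneg hl0]; linarith)
      -- The singularity of `log (1 - sin θ)` at `π/2` is traded through `hlog` for that of `log
      -- |cos θ|`, known to be integrable.
      have e2 : |Real.log (1 - Real.sin θ) - Real.log (Real.sin θ)| ≤
          1 + 2 * |Real.log (Real.cos θ)| + |Real.log (Real.sin θ)| := by
        refine (abs_sub _ _).trans (add_le_add ?_ le_rfl)
        rw [eq_sub_of_add_eq' hl]
        refine (abs_sub _ _).trans ?_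
        rw [abs_of_nonneg hl0, abs_mul, abs_two]
        linarith
      have e3 : Φ R θ = (cin ((1 + Real.sin θ) * R) - cin (Real.sin θ * R)) / 2 +
          (cin ((1 - Real.sin θ) * R) - cin (Real.sin θ * R)) / 2 := by
        simp only [hΦ]; ring
      rw [e3, Real.norm_eq_abs]
      refine (abs_add_le _ _).trans ?_
      rw [abs_div, abs_div, abs_two]
      linarith
    · exact (intervalIntegrable_const.add (hc.abs.const_mul 2)).add (hs.abs.const_mul 2)
    · filter_upwards [hsin] with θ hθ hmem
      obtain ⟨hs, h1, -⟩ := hθ hmem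
      have hlim : ∀ a : ℝ, 0 < a → Tendsto (fun R => cin (a * R) - Real.log (a * R)) atTop
          (𝓝 Real.eulerMascheroniConstant) := fun a ha =>
        tendsto_cin_sub_log.comp (tendsto_id.const_mul_atTop ha)
      have h := (((hlim _ (by linarith : 0 < 1 + Real.sin θ)).add (hlim _ h1)).div_const 2).sub
        (hlim _ hs)
      have h' := h.add_const (Real.log (Real.cos θ) - Real.log (Real.sin θ))
      rw [add_self_div_two, sub_self, zero_add] at h'
      refine h'.congr' ?_
      filter_upwards [eventually_gt_atTop 0] with R hR
      rw [Real.log_mul (by positivity) hR.ne', Real.log_mul hs.ne' hR.ne',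
        Real.log_mul h1.ne' hR.ne']
      have hl := hlog θ hs h1
      simp only [hΦ]
      linarith
  have hzero : ∫ θ in (0 : ℝ)..Real.pi, (Real.log (Real.cos θ) - Real.log (Real.sin θ)) = 0 := by
    rw [intervalIntegral.integral_sub hc hs, integral_log_cos_zero_pi, sub_self]
  rw [hzero] at hdct
  have h1 := intervalIntegral_tendsto_integral_Ioi 0 (integrableOn_cinKernel_mul_besselJ 0)
    tendsto_id
  have h2 := hdct.const_mul (1 / Real.pi)
  rw [mul_zero] at h2
  exact tendsto_nhds_unique h1 (h2.congr fun R => (hswap R).symm)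

/-! ### Evaluation of the Bessel integral and conclusion. -/

lemma integral_cinKernel_mul_besselJ_even (n : ℕ) :
    ∫ t in Ioi (0 : ℝ), cinKernel t * besselJ (2 * n) t = oddReciprocal n := by
  rcases n with _ | n
  · simpa [oddReciprocal] using integral_cinKernel_mul_besselJ_zero
  · have h1 := integral_besselJ_div n
    have h2 := integral_cos_mul_besselJ_div n
    have e : ∫ t in Ioi (0 : ℝ), cinKernel t * besselJ (2 * (n + 1)) t =
        (∫ t in Ioi (0 : ℝ), 1 * besselJ (2 * (n + 1)) t / t) -
          ∫ t in Ioi (0 : ℝ), Real.cos t * besselJ (2 * (n + 1)) t / t := by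
      have hi := fun (f : ℝ → ℝ) hf ho => integrableOn_mul_besselJ_div (f := f) hf ho (2 * n + 1)
      rw [show 2 * (n + 1) = 2 * n + 1 + 1 by ring,
        ← integral_sub (hi _ continuous_const one_isBigO) (hi _ Real.continuous_cos cos_isBigO)]
      refine integral_congr_ae (Eventually.of_forall fun t => ?_)
      simp only [cinKernel]
      ring
    have hn : ((2 * (n + 1) : ℕ) : ℝ) ≠ 0 := by positivity
    rw [e, oddReciprocal, show 2 * ((n + 1 : ℕ) : ℝ) = ((2 * (n + 1) : ℕ) : ℝ) by push_cast; ring,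
      eq_div_iff hn]
    linarith

lemma integral_cin_mul_besselJ_div (n : ℕ) :
    ((2 * n : ℕ) : ℝ) * (∫ t in Ioi (0 : ℝ), cin t * besselJ (2 * n) t / t) = neumannBeta n := by
  induction n with
  | zero => simp [neumannBeta_zero]
  | succ n ih =>
    have h := integral_cin_mul_besselJ_div_step (2 * n)
    rw [show 2 * n + 2 = 2 * (n + 1) by ring, ih, integral_cinKernel_mul_besselJ_even,
      integral_cinKernel_mul_besselJ_even] at h
    rw [neumannBeta_succ]
    linarith

theorem corollary2 (n : ℕ) (hn : 1 ≤ n) :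
    IntegrableOn (fun t : ℝ =>
      (Real.eulerMascheroniConstant + Real.log t - cosineIntegral t) * besselJ (2 * n) t / t)
      (Ioi 0) volume ∧
    IntervalIntegrable (fun t : ℝ => (1 - Real.cos (2 * (n : ℝ) * t)) * Real.cot t) volume
      0 (Real.pi / 2) ∧
    (∫ t in Ioi (0 : ℝ),
      (Real.eulerMascheroniConstant + Real.log t - cosineIntegral t) * besselJ (2 * n) t / t) =
      1 / (2 * (n : ℝ)) *
        ∫ t in (0 : ℝ)..(Real.pi / 2), (1 - Real.cos (2 * (n : ℝ) * t)) * Real.cot t ∧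
    1 / (2 * (n : ℝ)) *
        (∫ t in (0 : ℝ)..(Real.pi / 2), (1 - Real.cos (2 * (n : ℝ) * t)) * Real.cot t) =
      neumannBeta n / (2 * (n : ℝ)) ∧
    neumannBeta n / (2 * (n : ℝ)) =
      ∑ j ∈ Finset.range n,
        (-1 : ℝ) ^ j * 2 ^ (2 * j) / (((j : ℝ) + 1) * ((2 * j + 2)! : ℝ)) *
          (((n + j)! : ℝ) / ((n - j - 1)! : ℝ)) := by
  have hcin : EqOn (fun t : ℝ => cin t * besselJ (2 * n) t / t) (fun t : ℝ =>
      (Real.eulerMascheroniConstant + Real.log t - cosineIntegral t) * besselJ (2 * n) t / t)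
      (Ioi 0) := fun t ht => by
    simp only [cosineIntegral_eq (mem_Ioi.1 ht), sub_sub_cancel]
  refine ⟨?_, intervalIntegrable_one_sub_cos_mul_cot _ _ _, ?_, ?_, neumannBeta_div_eq_sum hn⟩
  · obtain ⟨k, hk⟩ := Nat.exists_eq_add_of_le' (show 1 ≤ 2 * n by omega)
    refine IntegrableOn.congr_fun ?_ hcin measurableSet_Ioi
    rw [hk]
    exact integrableOn_mul_besselJ_div continuous_cin cin_isBigO k
  · have h := integral_cin_mul_besselJ_div n
    have hn0 : (n : ℝ) ≠ 0 := by positivity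
    rw [← setIntegral_congr_fun measurableSet_Ioi hcin, integral_one_sub_cos_mul_cot, ← h]
    push_cast
    field_simp
  · rw [integral_one_sub_cos_mul_cot, one_div, inv_mul_eq_div]
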